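/- Let $K, I, J$ be finite sets and consider a stochastic game with state space $K$, action sets $I$ and $J$, and transition function $q:K\times I\times J\to\Delta(K)$. For stationary strategies $x:K\to\Delta(I)$ and $y:K\to\Delta(J)$ let $Q(x,y)\in\mathbb R^{K\times K}$ be the induced stochastic matrix, $Q(x,y)^{\ell,\ell'}=\sum_{i,j}x^\ell(i)\,y^\ell(j)\,q(\ell'\mid \ell,i,j)$. Let $(x_\lambda,y_\lambda)_{\lambda\in[0,1]}$ be a family of pairs of stationary strategies (for instance optimal ones in the $\lambda$-discounted games, extended by their limit at $\lambda=0$) such that $Q_\lambda:=Q(x_\lambda,y_\lambda)$ is critical: $Q_0=\mathrm{Id}$ and $$Q_\lambda=\mathrm{Id}+A\lambda+o(\lambda)\qquad(\lambda\to0^+)$$ for a matrix $A\in\mathbb R^{K\times K}$ with nonnegative off-diagonal entries and zero row sums. For a sequence $\theta=(\theta_m)_{m\ge1}$ of nonnegative weights with $\sum_{m\ge1}\theta_m=1$, put $\|\theta\|=\max_m\theta_m$, let $\lambda^\theta_m=\theta_m/\sum_{m'\ge m}\theta_{m'}$ (with $0/0=0$), let $Q^\theta_m=Q_{\lambda^\theta_m}$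 be the transition matrix at stage $m$ when the players use $x_{\lambda^\theta_m}$ and $y_{\lambda^\theta_m}$, and let $\varphi(\theta,t)=\inf\{M\ge1:\sum_{m=1}^M\theta_m\ge t\}\in\mathbb N\cup\{+\infty\}$, with $\inf\emptyset=+\infty$. Then for every $t\in[0,1]$ the limit $$\Pi_t:=\lim_{\|\theta\|\to0}\ \sum_{1\le m\le\varphi(\theta,t)}\theta_m\,Q^\theta_1Q^\theta_2\cdots Q^\theta_m$$ exists (the sums being absolutely convergent) and $$\Pi_t=\int_0^t e^{-\ln(1-s)A}\,ds,$$ where the integrand is integrable on $(0,t)$. -/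

import Mathlib

open Filter Topology

noncomputable section

/-- A (finite) stochastic game: `K` states, `I`, `J` the action sets, `g` the stage payoff and
`q k i j` the law of the next state. -/
structure StochasticGame (K I J : Type*) [Fintype K] where
  g : K → I → J → ℝ
  q : K → I → J → stdSimplex ℝ K

/-- A stationary strategy with actions in `I`: a mixed action for every state. -/
abbrev StationaryStrategy (K I : Type*) [Fintype I] := K → stdSimplex ℝ I

/-- The stochastic matrix on the state space induced by mixed actions `x k`, `y k` played in
each state `k`. -/
def StochasticGame.transitionMatrix {K I J : Type*} [Fintype K] [Fintype I] [Fintype J]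
    (G : StochasticGame K I J) (x : StationaryStrategy K I) (y : StationaryStrategy K J) :
    Matrix K K ℝ :=
  Matrix.of fun k l => ∑ i, ∑ j, (x k).1 i * (y k).1 j * (G.q k i j).1 l

/-- A normalized sequence of nonnegative weights `(θ_m)_{m ≥ 1}`; stages are numbered from `1`, and
the unused index `0` gets the weight `0`. -/
structure Evaluation where
  weight : ℕ → ℝ
  weight_zero : weight 0 = 0
  weight_nonneg : ∀ m, 0 ≤ weight m
  hasSum_weight : HasSum weight 1

namespace Evaluation

/-- `‖θ‖ = max_m θ_m`. -/
def maxWeight (θ : Evaluation) : ℝ := ⨆ m, θ.weight m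

/-- The filter `‖θ‖ → 0` on evaluations. -/
def vanishing : Filter Evaluation := comap maxWeight (𝓝 0)

/-- `λ_m = θ_m / ∑_{m' ≥ m} θ_{m'}`. (It is `0` when the tail is `0`; that only
happens after all the weight has been used.) -/
def discount (θ : Evaluation) (m : ℕ) : ℝ := θ.weight m / ∑' r, θ.weight (m + r)

/-- The clock function `φ(θ, t) = inf {M ≥ 1 | ∑_{m=1}^M θ_m ≥ t}`, which is `⊤` when
there is no such `M` (possible for `t = 1` only). -/
def clock (θ : Evaluation) (t : ℝ) : ℕ∞ :=
  ⨅ (M : ℕ) (_ : 1 ≤ M ∧ t ≤ ∑ m ∈ Finset.Icc 1 M, θ.weight m), (M : ℕ∞)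

/-- The Markov strategy which plays `x_{λ_m}` at stage `m`. -/
def strategy {K I : Type*} [Fintype I] (θ : Evaluation) (x : ℝ → StationaryStrategy K I) (m : ℕ) :
    StationaryStrategy K I := x (θ.discount m)

end Evaluation

/-- `A` is the transition (rate) matrix of a continuous-time Markov chain. -/
def IsRateMatrix {K : Type*} [Fintype K] (A : Matrix K K ℝ) : Prop :=
  (∀ k l, k ≠ l → 0 ≤ A k l) ∧ ∀ k, ∑ l, A k l = 0

/-- The family `(Q_r)` is critical with rate matrix `A`: `Q_r = Id + A r + o(r)` as `r → 0`, `r > 0`.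
At `r = 0`, which occurs as `λ_m` at the stages of weight zero, the family takes its limit value
`Id`. -/
def IsCriticalWith {K : Type*} [Fintype K] [DecidableEq K] (Q : ℝ → Matrix K K ℝ)
    (A : Matrix K K ℝ) : Prop :=
  IsRateMatrix A ∧ Q 0 = 1 ∧
    ∀ k l, (fun r : ℝ => (Q r - (1 + r • A)) k l) =o[𝓝[>] 0] (fun r : ℝ => r)

namespace StochasticGame

variable {K I J : Type*} [Fintype K] [Fintype I] [Fintype J]

/-- `Q^θ_m`: the transition matrix at stage `m` when the players use `x_{λ_m}`, `y_{λ_m}`. -/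
def stageMatrix (G : StochasticGame K I J) (x : ℝ → StationaryStrategy K I)
    (y : ℝ → StationaryStrategy K J) (θ : Evaluation) (m : ℕ) : Matrix K K ℝ :=
  G.transitionMatrix (θ.strategy x m) (θ.strategy y m)

/-- The term `θ_m Q^θ_1 ⋯ Q^θ_m` if `1 ≤ m ≤ φ(θ, t)`, and `0` for the other `m`. -/
def cumulatedTerm [DecidableEq K] (G : StochasticGame K I J) (x : ℝ → StationaryStrategy K I)
    (y : ℝ → StationaryStrategy K J) (θ : Evaluation) (t : ℝ) : ℕ → Matrix K K ℝ :=
  Set.indicator {m : ℕ | 1 ≤ m ∧ (m : ℕ∞) ≤ θ.clock t} fun m =>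
    θ.weight m • ((List.range m).map fun r => G.stageMatrix x y θ (r + 1)).prod

end StochasticGame

end

/-!
The stage weights satisfy `1 - s_n = (1 - s_{n-1}) (1 - λ_n)`, where `s_n = θ_1 + ⋯ + θ_n`. Hence
for the family `F_s = e^{-ln(1-s)A}`, which is multiplicative in `1 - s`, the product
`F_{λ_1} ⋯ F_{λ_n}` is exactly `F_{s_n}`. A product of contractions depends on its factors in a
Lipschitz way and `λ_1 + ⋯ + λ_n ≤ 1 / (1 - s)` up to the time at which the fraction `s < 1` of the
weight is used, so replacing `F` by any other family of contractions with the same derivative `A`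
at `0` changes this product only by `o(1)`. Thus `Q_{λ_1} ⋯ Q_{λ_{φ(θ, s)}} → F_s` for all `s < 1`.
The weighted sums are the integrals over `s` of these step functions, and dominated convergence
gives the limit. That `F` consists of contractions also comes from `Q`: as
`‖e^{rA}‖ ≤ ‖Q_r‖ + o(r) ≤ 1 + o(r)`, one has `‖e^{τA}‖ ≤ ‖e^{(τ/n)A}‖^n → 1`.
-/

open MeasureTheory

theorem intervalIntegrable_of_norm_le_one {E : Type*} [NormedAddCommGroup E] {f : ℝ → E}
    (hf : StronglyMeasurable f) (hf1 : ∀ s ∈ Set.Icc (0 : ℝ) 1, ‖f s‖ ≤ 1) {u v : ℝ}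
    (hu : u ∈ Set.Icc (0 : ℝ) 1) (hv : v ∈ Set.Icc (0 : ℝ) 1) :
    IntervalIntegrable f volume u v := by
  refine (intervalIntegrable_const (c := (1 : ℝ))).mono_fun hf.aestronglyMeasurable ?_
  refine (ae_restrict_mem measurableSet_uIoc).mono fun s hs => ?_
  simpa using hf1 s (Set.uIcc_subset_Icc hu hv (Set.uIoc_subset_uIcc hs))

section CriticalFamily

variable {𝔸 : Type*} [NormedRing 𝔸] [NormedAlgebra ℝ 𝔸]

/-- A family of contractions `Q r`, `0 ≤ r ≤ 1`, of a normed algebra with the expansion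
`Q r = 1 + r a + o(r)` as `r → 0`, `r ≥ 0`: the criticality of the transition matrices of a
stochastic game, with the stochasticity of `Q r` weakened to a bound on its norm. -/
structure IsCriticalFamily (Q : ℝ → 𝔸) (a : 𝔸) : Prop where
  map_zero : Q 0 = 1
  norm_le_one : ∀ r ∈ Set.Icc (0 : ℝ) 1, ‖Q r‖ ≤ 1
  hasDerivWithinAt : HasDerivWithinAt Q a (Set.Ici 0) 0

/-- `e^{-ln(1-s)a}`: the semigroup generated by `a` at the time which corresponds to the fraction
`s` of the game. At `s = 1` it takes the junk value `1`. -/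
noncomputable def fractionFlow (a : 𝔸) (s : ℝ) : 𝔸 :=
  NormedSpace.exp ((-Real.log (1 - s)) • a)

@[simp]
theorem fractionFlow_zero (a : 𝔸) : fractionFlow a 0 = 1 := by
  simp [fractionFlow]

theorem IsCriticalFamily.norm_one_le_one {Q : ℝ → 𝔸} {a : 𝔸} (hQ : IsCriticalFamily Q a) :
    ‖(1 : 𝔸)‖ ≤ 1 :=
  hQ.map_zero ▸ hQ.norm_le_one 0 ⟨le_rfl, zero_le_one⟩

theorem exists_norm_sub_le_of_hasDerivWithinAt {E : Type*} [NormedAddCommGroup E]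
    [NormedSpace ℝ E] {f g : ℝ → E} {v : E} (hf : HasDerivWithinAt f v (Set.Ici 0) 0)
    (hg : HasDerivWithinAt g v (Set.Ici 0) 0) (h0 : f 0 = g 0) {η : ℝ} (hη : 0 < η) :
    ∃ ρ > 0, ∀ r ∈ Set.Icc 0 ρ, ‖f r - g r‖ ≤ η * r := by
  have hbound : ∀ᶠ r in 𝓝[≥] (0 : ℝ), ‖f r - g r‖ ≤ η * ‖r‖ := by
    simpa [h0] using (hasDerivWithinAt_iff_isLittleO.1 (hf.sub hg)).bound hη
  obtain ⟨ρ, hρ, h⟩ := mem_nhdsGE_iff_exists_Icc_subset.1 hbound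
  exact ⟨ρ, hρ, fun r hr => by simpa only [Set.mem_ofPred_eq, Real.norm_of_nonneg hr.1] using h hr⟩

variable [CompleteSpace 𝔸]

theorem fractionFlow_mul (a : 𝔸) {s r : ℝ} (hs : s ≠ 1) (hr : r ≠ 1) :
    fractionFlow a s * fractionFlow a r = fractionFlow a (1 - (1 - s) * (1 - r)) := by
  let +nondep : NormedAlgebra ℚ 𝔸 := .restrictScalars ℚ ℝ 𝔸
  rw [fractionFlow, fractionFlow, fractionFlow, sub_sub_cancel,
    Real.log_mul (sub_ne_zero.2 hs.symm) (sub_ne_zero.2 hr.symm), neg_add, add_smul,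
    NormedSpace.exp_add_of_commute (((Commute.refl a).smul_left _).smul_right _)]

theorem hasDerivAt_fractionFlow (a : 𝔸) {s : ℝ} (hs : s ≠ 1) :
    HasDerivAt (fractionFlow a) ((1 - s)⁻¹ • (fractionFlow a s * a)) s := by
  have hlog : HasDerivAt (fun r : ℝ => -Real.log (1 - r)) (1 - s)⁻¹ s := by
    simpa [neg_div] using (((hasDerivAt_id s).const_sub 1).log (sub_ne_zero.2 hs.symm)).fun_neg
  exact (hasDerivAt_exp_smul_const (𝕂 := ℝ) a _).scomp s hlog

theorem stronglyMeasurable_fractionFlow (a : 𝔸) : StronglyMeasurable (fractionFlow a) := by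
  let +nondep : NormedAlgebra ℚ 𝔸 := .restrictScalars ℚ ℝ 𝔸
  have hexp : Continuous fun u : ℝ => NormedSpace.exp (u • a) :=
    NormedSpace.exp_continuous.comp (continuous_id.smul continuous_const)
  exact hexp.comp_stronglyMeasurable (by fun_prop : Measurable _).stronglyMeasurable

theorem norm_exp_smul_le_one_of_forall_exists {a : 𝔸}
    (h : ∀ η > 0, ∃ ρ > 0, ∀ r ∈ Set.Icc (0 : ℝ) ρ, ‖NormedSpace.exp (r • a)‖ ≤ 1 + η * r)
    {τ : ℝ} (hτ : 0 ≤ τ) : ‖NormedSpace.exp (τ • a)‖ ≤ 1 := by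
  let +nondep : NormedAlgebra ℚ 𝔸 := .restrictScalars ℚ ℝ 𝔸
  have hle : ∀ η > 0, ‖NormedSpace.exp (τ • a)‖ ≤ Real.exp (η * τ) := fun η hη => by
    obtain ⟨ρ, hρ, hr⟩ := h η hη
    obtain ⟨n, hn⟩ := exists_nat_gt (τ / ρ)
    have hn0 : (0 : ℝ) < n := (div_nonneg hτ hρ.le).trans_lt hn
    have hmem : τ / n ∈ Set.Icc 0 ρ :=
      ⟨by positivity, (div_le_iff₀ hn0).2 ((div_le_iff₀' hρ).1 hn.le)⟩
    calc ‖NormedSpace.exp (τ • a)‖ = ‖NormedSpace.exp ((τ / n) • a) ^ n‖ := by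
          rw [← NormedSpace.exp_nsmul, ← Nat.cast_smul_eq_nsmul ℝ, smul_smul,
            mul_div_cancel₀ _ hn0.ne']
      _ ≤ ‖NormedSpace.exp ((τ / n) • a)‖ ^ n := norm_pow_le' _ (Nat.cast_pos.1 hn0)
      _ ≤ Real.exp (η * (τ / n)) ^ n := by
          gcongr
          exact (hr _ hmem).trans ((add_comm _ _).trans_le (Real.add_one_le_exp _))
      _ = Real.exp (η * τ) := by
          rw [← Real.exp_nat_mul]
          congr 1
          field_simp
  have hlim : Tendsto (fun η : ℝ => Real.exp (η * τ)) (𝓝[>] 0) (𝓝 1) := by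
    have hcont : Continuous fun η : ℝ => Real.exp (η * τ) := by fun_prop
    simpa using hcont.continuousWithinAt (x := 0) (s := Set.Ioi 0) |>.tendsto
  exact ge_of_tendsto hlim (eventually_mem_nhdsWithin.mono hle)

namespace IsCriticalFamily

variable {Q : ℝ → 𝔸} {a : 𝔸}

theorem norm_exp_smul_le_one (hQ : IsCriticalFamily Q a) {τ : ℝ} (hτ : 0 ≤ τ) :
    ‖NormedSpace.exp (τ • a)‖ ≤ 1 := by
  refine norm_exp_smul_le_one_of_forall_exists (fun η hη => ?_) hτ
  have hexp : HasDerivWithinAt (fun r : ℝ => NormedSpace.exp (r • a)) a (Set.Ici 0) 0 := by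
    simpa using (hasDerivAt_exp_smul_const (𝕂 := ℝ) a 0).hasDerivWithinAt
  obtain ⟨ρ, hρ, h⟩ := exists_norm_sub_le_of_hasDerivWithinAt hexp hQ.hasDerivWithinAt
    (by simp [hQ.map_zero]) hη
  refine ⟨min ρ 1, by positivity, fun r ⟨hr0, hr⟩ => ?_⟩
  exact (norm_le_norm_add_norm_sub' _ (Q r)).trans (add_le_add
    (hQ.norm_le_one r ⟨hr0, hr.trans (min_le_right _ _)⟩) (h r ⟨hr0, hr.trans (min_le_left _ _)⟩))

protected theorem fractionFlow (hQ : IsCriticalFamily Q a) :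
    IsCriticalFamily (fractionFlow a) a where
  map_zero := fractionFlow_zero a
  norm_le_one r hr := hQ.norm_exp_smul_le_one
    (neg_nonneg.2 (Real.log_nonpos (sub_nonneg.2 hr.2) (sub_le_self 1 hr.1)))
  hasDerivWithinAt := by
    simpa using (hasDerivAt_fractionFlow a zero_ne_one).hasDerivWithinAt

theorem intervalIntegrable_fractionFlow (hQ : IsCriticalFamily Q a) {u v : ℝ}
    (hu : u ∈ Set.Icc (0 : ℝ) 1) (hv : v ∈ Set.Icc (0 : ℝ) 1) :
    IntervalIntegrable (fractionFlow a) volume u v :=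
  intervalIntegrable_of_norm_le_one (stronglyMeasurable_fractionFlow a)
    hQ.fractionFlow.norm_le_one hu hv

end IsCriticalFamily

end CriticalFamily

namespace Evaluation

variable (θ : Evaluation)

/-- The part `∑_{m=1}^n θ_m` of the total weight that is used in the first `n` stages. -/
def cumWeight (n : ℕ) : ℝ := ∑ m ∈ Finset.Icc 1 n, θ.weight m

@[simp]
theorem cumWeight_zero : θ.cumWeight 0 = 0 := by simp [cumWeight]

theorem cumWeight_succ (n : ℕ) : θ.cumWeight (n + 1) = θ.cumWeight n + θ.weight (n + 1) :=
  Finset.sum_Icc_succ_top (by lia) _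

theorem cumWeight_eq_sum_range (n : ℕ) :
    θ.cumWeight n = ∑ m ∈ Finset.range (n + 1), θ.weight m := by
  rw [Finset.sum_range_eq_add_Ico _ (by lia), θ.weight_zero, zero_add,
    Finset.Ico_add_one_right_eq_Icc, cumWeight]

theorem cumWeight_mono : Monotone θ.cumWeight :=
  monotone_nat_of_le_succ fun n => by
    rw [cumWeight_succ]
    exact le_add_of_nonneg_right (θ.weight_nonneg _)

theorem cumWeight_mem_Icc (n : ℕ) : θ.cumWeight n ∈ Set.Icc (0 : ℝ) 1 :=
  ⟨Finset.sum_nonneg fun _ _ => θ.weight_nonneg _,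
    sum_le_hasSum _ (fun _ _ => θ.weight_nonneg _) θ.hasSum_weight⟩

theorem tendsto_cumWeight : Tendsto θ.cumWeight atTop (𝓝 1) := by
  rw [funext θ.cumWeight_eq_sum_range]
  exact θ.hasSum_weight.tendsto_sum_nat.comp (tendsto_add_atTop_nat 1)

theorem weight_le_maxWeight (m : ℕ) : θ.weight m ≤ θ.maxWeight :=
  le_ciSup (f := θ.weight) ⟨1, Set.forall_mem_range.2 fun m =>
    le_hasSum θ.hasSum_weight m fun _ _ => θ.weight_nonneg _⟩ m

theorem tendsto_maxWeight : Tendsto maxWeight vanishing (𝓝 0) :=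
  tendsto_comap

theorem one_sub_cumWeight (n : ℕ) : 1 - θ.cumWeight n = ∑' r, θ.weight (n + 1 + r) := by
  rw [cumWeight_eq_sum_range, ← θ.hasSum_weight.tsum_eq,
    ← θ.hasSum_weight.summable.sum_add_tsum_nat_add (n + 1), add_sub_cancel_left]
  simp only [add_comm (n + 1)]

theorem weight_le_tsum_weight_add (m : ℕ) : θ.weight m ≤ ∑' r, θ.weight (m + r) :=
  (θ.hasSum_weight.summable.comp_injective (add_right_injective m)).le_tsum 0
    fun _ _ => θ.weight_nonneg _

theorem discount_mem_Icc (m : ℕ) : θ.discount m ∈ Set.Icc (0 : ℝ) 1 := by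
  have htail := (θ.weight_nonneg m).trans (θ.weight_le_tsum_weight_add m)
  exact ⟨div_nonneg (θ.weight_nonneg m) htail,
    div_le_one_of_le₀ (θ.weight_le_tsum_weight_add m) htail⟩

theorem discount_succ (n : ℕ) :
    θ.discount (n + 1) = θ.weight (n + 1) / (1 - θ.cumWeight n) := by
  rw [discount, one_sub_cumWeight]

theorem one_sub_cumWeight_succ {n : ℕ} (hn : θ.cumWeight n ≠ 1) :
    1 - θ.cumWeight (n + 1) = (1 - θ.cumWeight n) * (1 - θ.discount (n + 1)) := by
  rw [discount_succ, mul_sub, mul_div_cancel₀ _ (sub_ne_zero.2 hn.symm), cumWeight_succ]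
  ring

theorem discount_succ_le_weight_div {s : ℝ} (hs : s < 1) {n : ℕ} (hn : θ.cumWeight n ≤ s) :
    θ.discount (n + 1) ≤ θ.weight (n + 1) / (1 - s) := by
  rw [discount_succ]
  exact div_le_div_of_nonneg_left (θ.weight_nonneg _) (sub_pos.2 hs) (sub_le_sub_left hn 1)

theorem one_le_clock (s : ℝ) : 1 ≤ θ.clock s :=
  le_iInf₂ fun _ hM => mod_cast hM.1

theorem clock_mono : Monotone θ.clock := fun _ _ hst =>
  iInf_mono fun _ => iInf_mono' fun hM => ⟨⟨hM.1, hst.trans hM.2⟩, le_rfl⟩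

theorem clock_le_iff {s : ℝ} {M : ℕ} (hM : 1 ≤ M) : θ.clock s ≤ M ↔ s ≤ θ.cumWeight M := by
  refine ⟨fun h => ?_, fun h => iInf₂_le M ⟨hM, h⟩⟩
  have hlt : θ.clock s < (M + 1 : ℕ) := h.trans_lt (mod_cast M.lt_succ_self)
  simp only [clock, iInf_lt_iff, Nat.cast_lt] at hlt
  obtain ⟨N, hN, hNM⟩ := hlt
  exact hN.2.trans (θ.cumWeight_mono (Nat.lt_succ_iff.1 hNM))

theorem clock_ne_top {s : ℝ} (hs : s < 1) : θ.clock s ≠ ⊤ := by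
  obtain ⟨M, hM, hsM⟩ := ((eventually_ge_atTop 1).and
    (θ.tendsto_cumWeight.eventually_const_lt hs)).exists
  exact ne_top_of_le_ne_top (ENat.natCast_ne_top M) ((θ.clock_le_iff hM).2 hsM.le)

theorem exists_clock_eq_succ {s : ℝ} (hs : 0 ≤ s) (h : θ.clock s ≠ ⊤) :
    ∃ n : ℕ, θ.clock s = (n + 1 : ℕ) ∧ s ∈ Set.Icc (θ.cumWeight n) (θ.cumWeight (n + 1)) := by
  obtain ⟨M, hM⟩ := ENat.ne_top_iff_exists.1 h
  have hM1 : 1 ≤ M := by exact_mod_cast hM ▸ θ.one_le_clock s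
  obtain ⟨n, rfl⟩ := Nat.exists_eq_add_of_le' hM1
  refine ⟨n, hM.symm, ?_, (θ.clock_le_iff hM1).1 hM.ge⟩
  rcases n.eq_zero_or_pos with rfl | hn
  · simpa using hs
  · refine le_of_not_ge fun hsn => ?_
    have hle : ((n + 1 : ℕ) : ℕ∞) ≤ n := hM.le.trans ((θ.clock_le_iff hn).2 hsn)
    exact n.not_succ_le_self (mod_cast hle)

theorem clock_eq_succ {s : ℝ} {n : ℕ}
    (hs : s ∈ Set.Ioc (θ.cumWeight n) (θ.cumWeight (n + 1))) : θ.clock s = (n + 1 : ℕ) := by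
  refine le_antisymm ((θ.clock_le_iff n.succ_pos).2 hs.2) ?_
  rcases n.eq_zero_or_pos with rfl | hn
  · exact_mod_cast θ.one_le_clock s
  · exact_mod_cast Order.add_one_le_of_lt
      (lt_of_not_ge fun h => hs.1.not_ge ((θ.clock_le_iff hn).1 h))

/-- The stage `φ(θ, s)` at which the fraction `s` of the total weight is reached, as a natural
number; it is the junk value `0` if there is no such stage. -/
noncomputable def stageAt (s : ℝ) : ℕ := (θ.clock s).toNat

theorem measurable_stageAt : Measurable θ.stageAt := by
  have hclock : Measurable θ.clock := measurable_to_countable fun _ =>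
    (Set.ordConnected_singleton.preimage_mono θ.clock_mono).measurableSet
  exact Measurable.of_discrete.comp hclock

theorem exists_stageAt_eq_succ {s : ℝ} (hs : s ∈ Set.Ico (0 : ℝ) 1) :
    ∃ n, θ.stageAt s = n + 1 ∧ s ∈ Set.Icc (θ.cumWeight n) (θ.cumWeight (n + 1)) := by
  obtain ⟨n, hn, hsn⟩ := θ.exists_clock_eq_succ hs.1 (θ.clock_ne_top hs.2)
  exact ⟨n, by rw [stageAt, hn, ENat.toNat_natCast], hsn⟩

theorem abs_cumWeight_succ_sub_le {s : ℝ} {n : ℕ}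
    (hs : s ∈ Set.Icc (θ.cumWeight n) (θ.cumWeight (n + 1))) :
    |θ.cumWeight (n + 1) - s| ≤ θ.maxWeight := by
  rw [abs_of_nonneg (sub_nonneg.2 hs.2)]
  linarith [hs.1, θ.cumWeight_succ n, θ.weight_le_maxWeight (n + 1)]

theorem tendsto_cumWeight_stageAt {s : ℝ} (hs : s ∈ Set.Ico (0 : ℝ) 1) :
    Tendsto (fun θ : Evaluation => θ.cumWeight (θ.stageAt s)) vanishing (𝓝 s) := by
  refine tendsto_iff_dist_tendsto_zero.2
    (squeeze_zero (fun _ => dist_nonneg) (fun θ => ?_) tendsto_maxWeight)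
  obtain ⟨n, hn, hsn⟩ := θ.exists_stageAt_eq_succ hs
  rw [hn, Real.dist_eq]
  exact θ.abs_cumWeight_succ_sub_le hsn

section StageProd

variable {𝔸 : Type*} [NormedRing 𝔸]

/-- The product `Q_{λ_1} ⋯ Q_{λ_n}` over the first `n` stages, where `λ_m` is the discount factor
of stage `m`. -/
noncomputable def stageProd (Q : ℝ → 𝔸) (n : ℕ) : 𝔸 :=
  ((List.range n).map fun r => Q (θ.discount (r + 1))).prod

@[simp]
theorem stageProd_zero (Q : ℝ → 𝔸) : θ.stageProd Q 0 = 1 := by simp [stageProd]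

theorem stageProd_succ (Q : ℝ → 𝔸) (n : ℕ) :
    θ.stageProd Q (n + 1) = θ.stageProd Q n * Q (θ.discount (n + 1)) := by
  simp [stageProd, List.range_succ]

theorem stronglyMeasurable_stageProd_stageAt (Q : ℝ → 𝔸) :
    StronglyMeasurable fun s => θ.stageProd Q (θ.stageAt s) :=
  (StronglyMeasurable.of_discrete (f := θ.stageProd Q)).comp_measurable θ.measurable_stageAt

variable [NormedAlgebra ℝ 𝔸] {Q R : ℝ → 𝔸} {a b : 𝔸}

theorem norm_stageProd_le_one (hQ : IsCriticalFamily Q a) (n : ℕ) :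
    ‖θ.stageProd Q n‖ ≤ 1 := by
  induction n with
  | zero => simpa using hQ.norm_one_le_one
  | succ n ih =>
    rw [stageProd_succ]
    exact (norm_mul_le _ _).trans
      (mul_le_one₀ ih (norm_nonneg _) (hQ.norm_le_one _ (θ.discount_mem_Icc _)))

theorem norm_stageProd_sub_le (hQ : IsCriticalFamily Q a) (hR : IsCriticalFamily R b) (n : ℕ) :
    ‖θ.stageProd Q n - θ.stageProd R n‖ ≤
      ∑ m ∈ Finset.Icc 1 n, ‖Q (θ.discount m) - R (θ.discount m)‖ := by
  induction n with
  | zero => simp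
  | succ n ih =>
    have hsplit : θ.stageProd Q (n + 1) - θ.stageProd R (n + 1) =
        (θ.stageProd Q n - θ.stageProd R n) * Q (θ.discount (n + 1)) +
          θ.stageProd R n * (Q (θ.discount (n + 1)) - R (θ.discount (n + 1))) := by
      rw [stageProd_succ, stageProd_succ]
      noncomm_ring
    rw [hsplit, Finset.sum_Icc_succ_top (by lia)]
    refine (norm_add_le _ _).trans (add_le_add ?_ ?_)
    · exact (norm_mul_le_of_le ih (hQ.norm_le_one _ (θ.discount_mem_Icc _))).trans_eq (mul_one _)
    · exact (norm_mul_le_of_le (θ.norm_stageProd_le_one hR n) le_rfl).trans_eq (one_mul _)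

theorem norm_stageProd_succ_sub_le (hQ : IsCriticalFamily Q a) (hR : IsCriticalFamily R b)
    {η ρ s : ℝ} (hη : 0 ≤ η) (hQR : ∀ r ∈ Set.Icc 0 ρ, ‖Q r - R r‖ ≤ η * r) (hs : s < 1)
    (hθ : θ.maxWeight ≤ ρ * (1 - s)) {n : ℕ} (hn : θ.cumWeight n ≤ s) :
    ‖θ.stageProd Q (n + 1) - θ.stageProd R (n + 1)‖ ≤ η / (1 - s) := by
  have hs' : 0 < 1 - s := sub_pos.2 hs
  have hterm : ∀ m ∈ Finset.Icc 1 (n + 1),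
      ‖Q (θ.discount m) - R (θ.discount m)‖ ≤ η * (θ.weight m / (1 - s)) := fun m hm => by
    rw [Finset.mem_Icc] at hm
    obtain ⟨k, rfl⟩ := Nat.exists_eq_add_of_le' hm.1
    have hdiscount : θ.discount (k + 1) ≤ θ.weight (k + 1) / (1 - s) :=
      θ.discount_succ_le_weight_div hs ((θ.cumWeight_mono (by lia)).trans hn)
    have hρ : θ.discount (k + 1) ≤ ρ :=
      hdiscount.trans ((div_le_iff₀ hs').2 ((θ.weight_le_maxWeight _).trans hθ))
    exact (hQR _ ⟨(θ.discount_mem_Icc _).1, hρ⟩).trans (mul_le_mul_of_nonneg_left hdiscount hη)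
  calc ‖θ.stageProd Q (n + 1) - θ.stageProd R (n + 1)‖
      ≤ ∑ m ∈ Finset.Icc 1 (n + 1), η * (θ.weight m / (1 - s)) :=
        (θ.norm_stageProd_sub_le hQ hR _).trans (Finset.sum_le_sum hterm)
    _ = η / (1 - s) * θ.cumWeight (n + 1) := by
        rw [← Finset.mul_sum, ← Finset.sum_div, cumWeight, div_mul_eq_mul_div, mul_div_assoc]
    _ ≤ η / (1 - s) :=
        mul_le_of_le_one_right (div_nonneg hη hs'.le) (θ.cumWeight_mem_Icc _).2

theorem tendsto_stageProd_stageAt_sub (hQ : IsCriticalFamily Q a) (hR : IsCriticalFamily R a)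
    {s : ℝ} (hs : s ∈ Set.Ico (0 : ℝ) 1) :
    Tendsto (fun θ : Evaluation => θ.stageProd Q (θ.stageAt s) - θ.stageProd R (θ.stageAt s))
      vanishing (𝓝 0) := by
  have hs' : 0 < 1 - s := sub_pos.2 hs.2
  refine Metric.tendsto_nhds.2 fun ε hε => ?_
  obtain ⟨ρ, hρ, hQR⟩ := exists_norm_sub_le_of_hasDerivWithinAt hQ.hasDerivWithinAt
    hR.hasDerivWithinAt (hQ.map_zero.trans hR.map_zero.symm) (mul_pos (half_pos hε) hs')
  filter_upwards [tendsto_maxWeight.eventually_lt_const (mul_pos hρ hs')] with θ hθ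
  obtain ⟨n, hn, hsn⟩ := θ.exists_stageAt_eq_succ hs
  rw [dist_zero_right, hn]
  calc _ ≤ ε / 2 * (1 - s) / (1 - s) :=
        θ.norm_stageProd_succ_sub_le hQ hR (by positivity) hQR hs.2 hθ.le hsn.1
    _ < ε := by rw [mul_div_cancel_right₀ _ hs'.ne']; exact half_lt_self hε

variable [CompleteSpace 𝔸]

theorem stageProd_fractionFlow (a : 𝔸) {n : ℕ} (hn : θ.cumWeight n < 1) :
    θ.stageProd (fractionFlow a) n = fractionFlow a (θ.cumWeight n) := by
  induction n with
  | zero => simp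
  | succ n ih =>
    have hn' : θ.cumWeight n < 1 := (θ.cumWeight_mono n.le_succ).trans_lt hn
    have hmul := θ.one_sub_cumWeight_succ hn'.ne
    have hdiscount : θ.discount (n + 1) ≠ 1 := fun h => by
      rw [h, sub_self, mul_zero, sub_eq_zero] at hmul
      exact hn.ne' hmul
    rw [stageProd_succ, ih hn', fractionFlow_mul a hn'.ne hdiscount, ← hmul, sub_sub_cancel]

theorem tendsto_stageProd_stageAt (hQ : IsCriticalFamily Q a) {s : ℝ}
    (hs : s ∈ Set.Ico (0 : ℝ) 1) :
    Tendsto (fun θ : Evaluation => θ.stageProd Q (θ.stageAt s)) vanishing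
      (𝓝 (fractionFlow a s)) := by
  have hcum := tendsto_cumWeight_stageAt hs
  have hflow : Tendsto (fun θ : Evaluation => θ.stageProd (fractionFlow a) (θ.stageAt s))
      vanishing (𝓝 (fractionFlow a s)) := by
    refine ((hasDerivAt_fractionFlow a hs.2.ne).continuousAt.tendsto.comp hcum).congr' ?_
    filter_upwards [hcum.eventually_lt_const hs.2] with θ hθ
    exact (θ.stageProd_fractionFlow a hθ).symm
  simpa using (tendsto_stageProd_stageAt_sub hQ hQ.fractionFlow hs).add hflow

end StageProd

section ClockTerm

variable {𝔸 : Type*} [NormedRing 𝔸] [NormedAlgebra ℝ 𝔸] {Q : ℝ → 𝔸} {a : 𝔸}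

/-- The term `θ_m Q_{λ_1} ⋯ Q_{λ_m}` if `1 ≤ m ≤ φ(θ, t)`, and `0` for the other `m`. -/
noncomputable def clockTerm (Q : ℝ → 𝔸) (t : ℝ) : ℕ → 𝔸 :=
  Set.indicator {m : ℕ | 1 ≤ m ∧ (m : ℕ∞) ≤ θ.clock t} fun m => θ.weight m • θ.stageProd Q m

theorem intervalIntegrable_stageProd_stageAt (hQ : IsCriticalFamily Q a) {u v : ℝ}
    (hu : u ∈ Set.Icc (0 : ℝ) 1) (hv : v ∈ Set.Icc (0 : ℝ) 1) :
    IntervalIntegrable (fun s => θ.stageProd Q (θ.stageAt s)) volume u v :=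
  intervalIntegrable_of_norm_le_one (θ.stronglyMeasurable_stageProd_stageAt Q)
    (fun _ _ => θ.norm_stageProd_le_one hQ _) hu hv

theorem integral_stageProd_stageAt [CompleteSpace 𝔸] (Q : ℝ → 𝔸) (n : ℕ) :
    ∫ s in θ.cumWeight n..θ.cumWeight (n + 1), θ.stageProd Q (θ.stageAt s) =
      θ.weight (n + 1) • θ.stageProd Q (n + 1) := by
  have hconst : Set.EqOn (fun s => θ.stageProd Q (θ.stageAt s))
      (fun _ => θ.stageProd Q (n + 1)) (Set.uIoo (θ.cumWeight n) (θ.cumWeight (n + 1))) :=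
    fun s hs => by
      rw [Set.uIoo_of_le (θ.cumWeight_mono n.le_succ)] at hs
      simp only [stageAt, θ.clock_eq_succ (Set.Ioo_subset_Ioc_self hs), ENat.toNat_natCast]
  rw [intervalIntegral.integral_congr_uIoo hconst, intervalIntegral.integral_const,
    cumWeight_succ, add_sub_cancel_left]

theorem sum_range_clockTerm [CompleteSpace 𝔸] (hQ : IsCriticalFamily Q a) {t : ℝ} {n : ℕ}
    (hn : n ≤ θ.clock t) :
    ∑ m ∈ Finset.range (n + 1), θ.clockTerm Q t m =
      ∫ s in (0 : ℝ)..θ.cumWeight n, θ.stageProd Q (θ.stageAt s) := by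
  have hzero : θ.clockTerm Q t 0 = 0 := by simp [clockTerm]
  have hterm : ∀ m < n, θ.clockTerm Q t (m + 1) =
      ∫ s in θ.cumWeight m..θ.cumWeight (m + 1), θ.stageProd Q (θ.stageAt s) := fun m hm => by
    have hmem : m + 1 ∈ {m : ℕ | 1 ≤ m ∧ (m : ℕ∞) ≤ θ.clock t} :=
      ⟨by lia, (Nat.cast_le.2 hm).trans hn⟩
    rw [integral_stageProd_stageAt, clockTerm, Set.indicator_of_mem hmem]
  rw [Finset.sum_range_succ', hzero, add_zero,
    Finset.sum_congr rfl fun m hm => hterm m (Finset.mem_range.1 hm),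
    intervalIntegral.sum_integral_adjacent_intervals fun m _ =>
      θ.intervalIntegrable_stageProd_stageAt hQ (θ.cumWeight_mem_Icc m) (θ.cumWeight_mem_Icc _),
    cumWeight_zero]

variable [CompleteSpace 𝔸]

theorem summable_clockTerm (hQ : IsCriticalFamily Q a) (t : ℝ) : Summable (θ.clockTerm Q t) := by
  refine Summable.of_norm_bounded θ.hasSum_weight.summable fun m => ?_
  refine (norm_indicator_le_norm_self _ _).trans ?_
  rw [norm_smul, Real.norm_of_nonneg (θ.weight_nonneg m)]
  exact mul_le_of_le_one_right (θ.weight_nonneg m) (θ.norm_stageProd_le_one hQ m)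

theorem tsum_clockTerm_of_clock_eq_top (hQ : IsCriticalFamily Q a) {t : ℝ}
    (ht : θ.clock t = ⊤) :
    ∑' m, θ.clockTerm Q t m = ∫ s in (0 : ℝ)..1, θ.stageProd Q (θ.stageAt s) := by
  have hsum := (θ.summable_clockTerm hQ t).hasSum.tendsto_sum_nat.comp (tendsto_add_atTop_nat 1)
  have hprimitive := intervalIntegral.continuousOn_primitive_interval'
    (θ.intervalIntegrable_stageProd_stageAt hQ ⟨le_rfl, zero_le_one⟩ ⟨zero_le_one, le_rfl⟩)
    Set.left_mem_uIcc 1 Set.right_mem_uIcc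
  have hcum : Tendsto θ.cumWeight atTop (𝓝[Set.uIcc 0 1] 1) :=
    tendsto_nhdsWithin_iff.2 ⟨θ.tendsto_cumWeight, Eventually.of_forall fun n => by
      simpa using θ.cumWeight_mem_Icc n⟩
  exact tendsto_nhds_unique hsum ((hprimitive.tendsto.comp hcum).congr fun n =>
    (θ.sum_range_clockTerm hQ (ht ▸ le_top)).symm)

theorem tsum_clockTerm_of_clock_eq (hQ : IsCriticalFamily Q a) {t : ℝ} {M : ℕ}
    (hM : θ.clock t = M) :
    ∑' m, θ.clockTerm Q t m = ∫ s in (0 : ℝ)..θ.cumWeight M, θ.stageProd Q (θ.stageAt s) := by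
  rw [← θ.sum_range_clockTerm hQ hM.ge]
  refine tsum_eq_sum fun m hm => Set.indicator_of_notMem (fun hmem => hm ?_) _
  exact Finset.mem_range_succ_iff.2 (Nat.cast_le.1 (hmem.2.trans_eq hM))

theorem dist_integral_tsum_clockTerm_le (hQ : IsCriticalFamily Q a) {t : ℝ}
    (ht : t ∈ Set.Icc (0 : ℝ) 1) :
    dist (∫ s in (0 : ℝ)..t, θ.stageProd Q (θ.stageAt s)) (∑' m, θ.clockTerm Q t m) ≤
      θ.maxWeight := by
  by_cases htop : θ.clock t = ⊤
  · obtain rfl : t = 1 := ht.2.antisymm (le_of_not_gt fun h => θ.clock_ne_top h htop)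
    rw [θ.tsum_clockTerm_of_clock_eq_top hQ htop, dist_self]
    exact (θ.weight_nonneg 0).trans (θ.weight_le_maxWeight 0)
  · obtain ⟨n, hn, htn⟩ := θ.exists_clock_eq_succ ht.1 htop
    have h0 : (0 : ℝ) ∈ Set.Icc (0 : ℝ) 1 := ⟨le_rfl, zero_le_one⟩
    rw [θ.tsum_clockTerm_of_clock_eq hQ hn, dist_comm, dist_eq_norm,
      intervalIntegral.integral_interval_sub_left
        (θ.intervalIntegrable_stageProd_stageAt hQ h0 (θ.cumWeight_mem_Icc _))
        (θ.intervalIntegrable_stageProd_stageAt hQ h0 ht)]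
    refine (intervalIntegral.norm_integral_le_of_norm_le_const
      fun s _ => θ.norm_stageProd_le_one hQ (θ.stageAt s)).trans ?_
    rw [one_mul]
    exact θ.abs_cumWeight_succ_sub_le htn

theorem tendsto_integral_stageProd_stageAt (hQ : IsCriticalFamily Q a) {t : ℝ}
    (ht : t ∈ Set.Icc (0 : ℝ) 1) :
    Tendsto (fun θ : Evaluation => ∫ s in (0 : ℝ)..t, θ.stageProd Q (θ.stageAt s)) vanishing
      (𝓝 (∫ s in (0 : ℝ)..t, fractionFlow a s)) := by
  have : vanishing.IsCountablyGenerated := comap.isCountablyGenerated _ _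
  refine intervalIntegral.tendsto_integral_filter_of_dominated_convergence (fun _ => 1)
    (Eventually.of_forall fun θ =>
      (θ.stronglyMeasurable_stageProd_stageAt Q).aestronglyMeasurable)
    (Eventually.of_forall fun θ => ae_of_all _ fun s _ => θ.norm_stageProd_le_one hQ _)
    intervalIntegrable_const ?_
  filter_upwards [Measure.ae_ne volume (1 : ℝ)] with s hs1 hs
  rw [Set.uIoc_of_le ht.1] at hs
  exact tendsto_stageProd_stageAt hQ ⟨hs.1.le, (hs.2.trans ht.2).lt_of_ne hs1⟩

theorem tendsto_tsum_clockTerm (hQ : IsCriticalFamily Q a) {t : ℝ}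
    (ht : t ∈ Set.Icc (0 : ℝ) 1) :
    Tendsto (fun θ : Evaluation => ∑' m, θ.clockTerm Q t m) vanishing
      (𝓝 (∫ s in (0 : ℝ)..t, fractionFlow a s)) :=
  (tendsto_integral_stageProd_stageAt hQ ht).congr_dist (squeeze_zero (fun _ => dist_nonneg)
    (fun θ => θ.dist_integral_tsum_clockTerm_le hQ ht) tendsto_maxWeight)

end ClockTerm

end Evaluation

theorem mainTheorem8_general {𝔸 : Type*} [NormedRing 𝔸] [NormedAlgebra ℝ 𝔸] [CompleteSpace 𝔸]
    {Q : ℝ → 𝔸} {a : 𝔸} (hQ : IsCriticalFamily Q a) {t : ℝ} (ht : t ∈ Set.Icc (0 : ℝ) 1) :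
    (∀ θ : Evaluation, Summable (θ.clockTerm Q t)) ∧
    IntervalIntegrable (fun s : ℝ => NormedSpace.exp ((-Real.log (1 - s)) • a)) volume 0 t ∧
    Tendsto (fun θ : Evaluation => ∑' m, θ.clockTerm Q t m) Evaluation.vanishing
      (𝓝 (∫ s in (0 : ℝ)..t, NormedSpace.exp ((-Real.log (1 - s)) • a))) :=
  ⟨fun θ => θ.summable_clockTerm hQ t,
    hQ.intervalIntegrable_fractionFlow ⟨le_rfl, zero_le_one⟩ ht,
    Evaluation.tendsto_tsum_clockTerm hQ ht⟩

section MatrixNorm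

open scoped Matrix.Norms.Operator

variable {K : Type*} [Fintype K] [DecidableEq K]

theorem linfty_opNorm_le_one_of_mem_rowStochastic {P : Matrix K K ℝ}
    (hP : P ∈ Matrix.rowStochastic ℝ K) : ‖P‖ ≤ 1 := by
  rw [Matrix.linfty_opNorm_def, ← NNReal.coe_one, NNReal.coe_le_coe]
  refine Finset.sup_le fun k _ => NNReal.coe_le_coe.1 ?_
  simp only [NNReal.coe_sum, coe_nnnorm, NNReal.coe_one,
    Real.norm_of_nonneg (Matrix.nonneg_of_mem_rowStochastic hP),
    Matrix.sum_row_of_mem_rowStochastic hP, le_refl]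

theorem StochasticGame.transitionMatrix_mem_rowStochastic {I J : Type*} [Fintype I] [Fintype J]
    (G : StochasticGame K I J) (x : StationaryStrategy K I) (y : StationaryStrategy K J) :
    G.transitionMatrix x y ∈ Matrix.rowStochastic ℝ K := by
  refine Matrix.mem_rowStochastic_iff_sum.2 ⟨fun k l => ?_, fun k => ?_⟩
  · exact Finset.sum_nonneg fun i _ => Finset.sum_nonneg fun j _ =>
      mul_nonneg (mul_nonneg ((x k).2.1 i) ((y k).2.1 j)) ((G.q k i j).2.1 l)
  · calc ∑ l, G.transitionMatrix x y k l
        = ∑ i, ∑ j, (x k).1 i * (y k).1 j * ∑ l, (G.q k i j).1 l := by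
          simp only [StochasticGame.transitionMatrix, Matrix.of_apply, Finset.mul_sum]
          rw [Finset.sum_comm]
          exact Finset.sum_congr rfl fun i _ => Finset.sum_comm
      _ = 1 := by
          simp only [(G.q k _ _).2.2, mul_one, ← Finset.mul_sum, (y k).2.2, (x k).2.2]

theorem IsCriticalWith.isCriticalFamily {Q : ℝ → Matrix K K ℝ} {A : Matrix K K ℝ}
    (hQ : IsCriticalWith Q A) (hstoch : ∀ r, Q r ∈ Matrix.rowStochastic ℝ K) :
    IsCriticalFamily Q A where
  map_zero := hQ.2.1
  norm_le_one r _ := linfty_opNorm_le_one_of_mem_rowStochastic (hstoch r)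
  hasDerivWithinAt := by
    have hentry : ∀ k l, HasDerivWithinAt (fun r => Q r k l) (A k l) (Set.Ici 0) 0 :=
      fun k l => hasDerivWithinAt_Ioi_iff_Ici.1 <| hasDerivWithinAt_iff_isLittleO.2 <| by
        simpa [hQ.2.1, sub_sub] using hQ.2.2 k l
    exact hasDerivWithinAt_pi.2 fun k => hasDerivWithinAt_pi.2 (hentry k)

namespace IsCriticalFamily

variable {Q : ℝ → Matrix K K ℝ} {A : Matrix K K ℝ} {u v : ℝ}

theorem intervalIntegrable_fractionFlow_apply (hQ : IsCriticalFamily Q A)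
    (hu : u ∈ Set.Icc (0 : ℝ) 1) (hv : v ∈ Set.Icc (0 : ℝ) 1) (k l : K) :
    IntervalIntegrable (fun s => fractionFlow A s k l) volume u v :=
  let entry := (Matrix.entryLinearMap ℝ ℝ k l).toContinuousLinearMap
  have hint := hQ.intervalIntegrable_fractionFlow hu hv
  ⟨entry.integrable_comp hint.1, entry.integrable_comp hint.2⟩

theorem integral_fractionFlow_eq_of (hQ : IsCriticalFamily Q A)
    (hu : u ∈ Set.Icc (0 : ℝ) 1) (hv : v ∈ Set.Icc (0 : ℝ) 1) :
    ∫ s in u..v, fractionFlow A s = Matrix.of fun k l => ∫ s in u..v, fractionFlow A s k l :=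
  Matrix.ext fun k l =>
    ((Matrix.entryLinearMap ℝ ℝ k l).toContinuousLinearMap.intervalIntegral_comp_comm
      (hQ.intervalIntegrable_fractionFlow hu hv)).symm

end IsCriticalFamily

end MatrixNorm

theorem mainTheorem8 {K I J : Type*} [Fintype K] [DecidableEq K] [Fintype I] [Fintype J]
    (G : StochasticGame K I J)
    (x : ℝ → StationaryStrategy K I) (y : ℝ → StationaryStrategy K J)
    (A : Matrix K K ℝ)
    (hQ : IsCriticalWith (fun r => G.transitionMatrix (x r) (y r)) A)
    (t : ℝ) (ht : t ∈ Set.Icc (0 : ℝ) 1) :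
    (∀ θ : Evaluation, Summable (G.cumulatedTerm x y θ t)) ∧
    (∀ k l, IntervalIntegrable (fun s : ℝ => NormedSpace.exp ((-Real.log (1 - s)) • A) k l)
      MeasureTheory.volume 0 t) ∧
    Tendsto (fun θ : Evaluation => ∑' m, G.cumulatedTerm x y θ t m) Evaluation.vanishing
      (𝓝 (Matrix.of fun k l => ∫ s in (0 : ℝ)..t,
        NormedSpace.exp ((-Real.log (1 - s)) • A) k l)) := by
  open scoped Matrix.Norms.Operator in
  have hfamily := hQ.isCriticalFamily fun r => G.transitionMatrix_mem_rowStochastic (x r) (y r)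
  have h0 : (0 : ℝ) ∈ Set.Icc (0 : ℝ) 1 := ⟨le_rfl, zero_le_one⟩
  obtain ⟨hsum, -, hlim⟩ := mainTheorem8_general hfamily ht
  exact ⟨hsum, hfamily.intervalIntegrable_fractionFlow_apply h0 ht,
    hfamily.integral_fractionFlow_eq_of h0 ht ▸ hlim⟩
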